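/- Let $K_1,K_2,K_3>0$. There is a constant $C=C(K_1,K_2,K_3)$, depending only on $K_1,K_2,K_3$, such that the following holds. Let $m,n$ be positive integers and let $p_1,\dots,p_n\ge 0$ with $\sum_{i=1}^n p_i=1$. Distribute $m$ balls independently among $n$ urns, each ball being placed in urn $i$ with probability $p_i$, and let $\xi_i$ be the number of balls in urn $i$ after all $m$ balls have been distributed. Let $\varphi_1,\dots,\varphi_n$ be real-valued functions on the non-negative integers with $$|\varphi_i(x)|\le K_1e^{K_1x}\qquad\text{for all integers } x\ge 0 \text{ and all } 1\le i\le n,$$ and assume that $$\sup_{1\le i\le n}p_i\le \frac{K_2}{m}\qquad\text{and}\qquad n\le K_3m.$$ Put $\mu_i=\mathbb{E}\varphi_i(\xi_i)$ and $\sigma^2=\mathrm{Var}\bigl(\sum_{i=1}^n\varphi_i(\xi_i)\bigr)$, assume that $\sigma>0$, and let $$W=\frac1\sigma\sum_{i=1}^n\bigl(\varphi_i(\xi_i)-\mu_i\bigr).$$ Then $$d_{\mathrm K}\bigl(\mathscr L(W),\mathcal N(0,1)\bigr)\le C\left(\frac{n^{1/2}}{\sigma^2}+\frac{n}{\sigma^3}\right),$$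 where $d_{\mathrm K}(\mathscr L(W),\mathcal N(0,1))=\sup_{z\in\mathbb R}|\mathbb P(W\le z)-\Phi(z)|$ is the Kolmogorov distance and $\Phi$ is the standard normal distribution function. -/

import Mathlib

open MeasureTheory ProbabilityTheory

noncomputable section

/-- The Kolmogorov distance `sup_z |P((-∞, z]) - Q((-∞, z])|` between two laws on the real line. -/
def kolmogorovDist (P Q : Measure ℝ) : ℝ :=
  ⨆ z : ℝ, |P.real (Set.Iic z) - Q.real (Set.Iic z)|

namespace Occupancy

variable {Ω : Type*} {m n : ℕ}

/-- `X j` is the urn into which ball `j` falls: the `m` balls are independent, and each of them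
falls into urn `i` with probability `p i`. -/
structure IsUrnScheme [MeasurableSpace Ω] (P : Measure Ω) (p : Fin n → ℝ)
    (X : Fin m → Ω → Fin n) : Prop where
  measurable : ∀ j, Measurable (X j)
  indep : iIndepFun X P
  law : ∀ j i, P.real (X j ⁻¹' {i}) = p i

/-- `ξ_i`, the number of balls in urn `i`. -/
def count (X : Fin m → Ω → Fin n) (i : Fin n) (ω : Ω) : ℕ :=
  (Finset.univ.filter fun j => X j ω = i).card

/-- The additive functional `V = ∑ φ_i(ξ_i)`. -/
def V (X : Fin m → Ω → Fin n) (φ : Fin n → ℕ → ℝ) (ω : Ω) : ℝ :=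
  ∑ i, φ i (count X i ω)

/-- The mean `μ_i = E φ_i(ξ_i)`. -/
def mean [MeasurableSpace Ω] (P : Measure Ω) (X : Fin m → Ω → Fin n) (φ : Fin n → ℕ → ℝ)
    (i : Fin n) : ℝ :=
  ∫ ω, φ i (count X i ω) ∂P

/-- `σ`, the standard deviation of `V`. -/
def sd [MeasurableSpace Ω] (P : Measure Ω) (X : Fin m → Ω → Fin n) (φ : Fin n → ℕ → ℝ) : ℝ :=
  √(variance (V X φ) P)

/-- The standardized statistic `W = σ⁻¹ ∑ (φ_i(ξ_i) - μ_i)`. -/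
def W [MeasurableSpace Ω] (P : Measure Ω) (X : Fin m → Ω → Fin n) (φ : Fin n → ℕ → ℝ)
    (ω : Ω) : ℝ :=
  (1 / sd P X φ) * ∑ i, (φ i (count X i ω) - mean P X φ i)

end Occupancy

end

/-! This is Stein's method on the finite product space of configurations `x : Fin m → Fin n`, with
an independent copy of every ball. Let `Δ_j` be the change of a function when ball `j` is resampled,
and `D_j` the `j`-th step of the path that replaces the balls one by one by their copies. Swapping
ball `j` with its copy negates both, and the `D_j` telescope, so `E ∑ Δ_j g · D_j h = 2 Cov(g, h)`
(`prodExp_sum_resampleDiff_mul_hybridDiff`). With `g = f(W)`, where `f` is the Stein solution `sol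
t`, this rewrites `E W f(W)` through increments of `f`.

The increments are linearised by `abs_sol_sub_sol_sub_le`. The main term is governed by `T₁ = ∑ Δ_j
V · D_j V`, of mean `2σ²`; the smooth remainder is a third moment of size `n / σ³`. The jump of `f'`
at `t` leaves differences of indicators weighted by `|D_j V| Δ_j V`. These weights are
antisymmetric, so symmetrisation turns the jump term into a bounded multiple of `T₂ = ∑ |D_j V| Δ_j
V`, which has mean zero; no concentration inequality is needed.

It remains to see that `T₁` and `T₂` have variance `O(n)` (`variance_diffSum_le`). By the
Efron–Stein bound it suffices to control the effect of one ball, and balls interact only through a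
common urn. The exponential growth of `φ` is absorbed by exponential moments of urn loads, which are
bounded because each urn is hit with probability `O(1/m)` (`prodExp_expLoad_le`). -/

namespace Occupancy

/-! ### Product expectations, the covariance identity and the Efron–Stein bound. -/

section ProductExpectation

variable {m : ℕ} {α : Type*}

/-- Exchange the two entries of the `j`-th pair. -/
def swapAt (j : Fin m) (z : Fin m → α × α) : Fin m → α × α :=
  fun i => if i = j then (z i).swap else z i

/-- The first entries, except that the entries with index below `k` are the second ones. -/
def hybrid (k : ℕ) (z : Fin m → α × α) : Fin m → α :=
  fun i => if (i : ℕ) < k then (z i).2 else (z i).1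

/-- The first entries, except that the `j`-th one is the second one. -/
def resample (j : Fin m) (z : Fin m → α × α) : Fin m → α :=
  fun i => if i = j then (z i).2 else (z i).1

/-- The effect on `h` of resampling the `j`-th coordinate. -/
def resampleDiff (h : (Fin m → α) → ℝ) (j : Fin m) (z : Fin m → α × α) : ℝ :=
  h (fun i => (z i).1) - h (resample j z)

/-- The `j`-th step on the path which replaces the coordinates one after another. -/
def hybridDiff (h : (Fin m → α) → ℝ) (j : Fin m) (z : Fin m → α × α) : ℝ :=
  h (hybrid j z) - h (hybrid (j + 1) z)

theorem resample_swapAt (j : Fin m) (z : Fin m → α × α) :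
    resample j (swapAt j z) = fun i => (z i).1 := by
  funext i; by_cases h : i = j <;> simp [resample, swapAt, h]

theorem fst_swapAt (j : Fin m) (z : Fin m → α × α) :
    (fun i => (swapAt j z i).1) = resample j z := by
  funext i; by_cases h : i = j <;> simp [resample, swapAt, h]

theorem hybrid_swapAt (j : Fin m) (z : Fin m → α × α) :
    hybrid j (swapAt j z) = hybrid (j + 1) z := by
  funext i
  by_cases h : i = j
  · simp [hybrid, swapAt, h]
  · have h' : (i : ℕ) ≠ j := fun e => h (Fin.ext e)
    have : (i : ℕ) < j + 1 ↔ (i : ℕ) < j := by omega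
    simp [hybrid, swapAt, h, this]

theorem hybrid_succ_swapAt (j : Fin m) (z : Fin m → α × α) :
    hybrid (j + 1) (swapAt j z) = hybrid j z := by
  funext i
  by_cases h : i = j
  · simp [hybrid, swapAt, h]
  · have h' : (i : ℕ) ≠ j := fun e => h (Fin.ext e)
    have : (i : ℕ) < j + 1 ↔ (i : ℕ) < j := by omega
    simp [hybrid, swapAt, h, this]

theorem hybridDiff_swapAt (h : (Fin m → α) → ℝ) (j : Fin m) (z : Fin m → α × α) :
    hybridDiff h j (swapAt j z) = -hybridDiff h j z := by
  simp [hybridDiff, hybrid_swapAt, hybrid_succ_swapAt]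

theorem resampleDiff_swapAt (h : (Fin m → α) → ℝ) (j : Fin m) (z : Fin m → α × α) :
    resampleDiff h j (swapAt j z) = -resampleDiff h j z := by
  simp [resampleDiff, resample_swapAt, fst_swapAt]

theorem sum_hybridDiff (h : (Fin m → α) → ℝ) (z : Fin m → α × α) :
    ∑ j, hybridDiff h j z = h (fun i => (z i).1) - h (fun i => (z i).2) := by
  have e := Finset.sum_range_sub' (fun k => h (hybrid k z)) m
  rw [← Fin.sum_univ_eq_sum_range (fun k => h (hybrid k z) - h (hybrid (k + 1) z))] at e
  have e0 : hybrid 0 z = fun i => (z i).1 := by funext i; simp [hybrid]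
  have em : hybrid m z = fun i => (z i).2 := by funext i; simp [hybrid]
  rw [e0, em] at e
  exact e

/-- A probability weight on a finite type. -/
structure IsWeight [Fintype α] (w : α → ℝ) : Prop where
  nonneg : ∀ a, 0 ≤ w a
  sum_eq_one : ∑ a, w a = 1

/-- The expectation of `F` under the `m`-fold product of the weight `w`. -/
noncomputable def prodExp [Fintype α] (w : α → ℝ) (F : (Fin m → α) → ℝ) : ℝ :=
  ∑ x, (∏ j, w (x j)) * F x

/-- The product weight on pairs. -/
def pairWeight (w : α → ℝ) (a : α × α) : ℝ := w a.1 * w a.2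

theorem IsWeight.pairWeight [Fintype α] {w : α → ℝ} (hw : IsWeight w) :
    IsWeight (pairWeight w) where
  nonneg a := mul_nonneg (hw.nonneg _) (hw.nonneg _)
  sum_eq_one := by
    simp only [Occupancy.pairWeight, Fintype.sum_prod_type, ← Finset.mul_sum, hw.sum_eq_one,
      mul_one]

variable [Fintype α] {w : α → ℝ}

theorem prodExp_add (F G : (Fin m → α) → ℝ) :
    prodExp w (fun x => F x + G x) = prodExp w F + prodExp w G := by
  simp [prodExp, mul_add, Finset.sum_add_distrib]

theorem prodExp_sub (F G : (Fin m → α) → ℝ) :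
    prodExp w (fun x => F x - G x) = prodExp w F - prodExp w G := by
  simp [prodExp, mul_sub, Finset.sum_sub_distrib]

theorem prodExp_const_mul (c : ℝ) (F : (Fin m → α) → ℝ) :
    prodExp w (fun x => c * F x) = c * prodExp w F := by
  simp only [prodExp, Finset.mul_sum]
  exact Finset.sum_congr rfl fun x _ => by ring

theorem prodExp_sum {ι : Type*} (s : Finset ι) (F : ι → (Fin m → α) → ℝ) :
    prodExp w (fun x => ∑ i ∈ s, F i x) = ∑ i ∈ s, prodExp w (F i) := by
  simp only [prodExp, Finset.mul_sum]
  exact Finset.sum_comm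

theorem prodExp_prod (g : α → ℝ) :
    prodExp w (fun x : Fin m → α => ∏ j, g (x j)) = (∑ a, w a * g a) ^ m := by
  simp only [prodExp, ← Finset.prod_mul_distrib]
  rw [Fintype.sum_pow]

theorem prodExp_const (hw : IsWeight w) (c : ℝ) :
    prodExp w (fun _ : Fin m → α => c) = c := by
  have h := prodExp_prod (m := m) (w := w) (fun _ => 1)
  simp only [Finset.prod_const_one, mul_one, hw.sum_eq_one, one_pow] at h
  have := prodExp_const_mul (m := m) (w := w) c (fun _ => 1)
  rw [h] at this
  simpa using this

theorem prod_weight_nonneg (hw : IsWeight w) (x : Fin m → α) : 0 ≤ ∏ j, w (x j) :=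
  Finset.prod_nonneg fun _ _ => hw.nonneg _

theorem prodExp_mono (hw : IsWeight w) {F G : (Fin m → α) → ℝ} (h : ∀ x, F x ≤ G x) :
    prodExp w F ≤ prodExp w G :=
  Finset.sum_le_sum fun x _ => mul_le_mul_of_nonneg_left (h x) (prod_weight_nonneg hw x)

theorem abs_prodExp_le (hw : IsWeight w) (F : (Fin m → α) → ℝ) :
    |prodExp w F| ≤ prodExp w (fun x => |F x|) := by
  refine (Finset.abs_sum_le_sum_abs _ _).trans (Finset.sum_le_sum fun x _ => ?_)
  rw [abs_mul, abs_of_nonneg (prod_weight_nonneg hw x)]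

theorem prodExp_mul_le_sqrt (hw : IsWeight w) (F G : (Fin m → α) → ℝ) :
    prodExp w (fun x => F x * G x) ≤
      √(prodExp w fun x => F x ^ 2) * √(prodExp w fun x => G x ^ 2) := by
  have h := Real.sum_mul_le_sqrt_mul_sqrt Finset.univ
    (fun x : Fin m → α => √(∏ j, w (x j)) * F x) (fun x => √(∏ j, w (x j)) * G x)
  have e : ∀ (A B : (Fin m → α) → ℝ) x, (√(∏ j, w (x j)) * A x) * (√(∏ j, w (x j)) * B x)
      = (∏ j, w (x j)) * (A x * B x) := fun A B x => by
    rw [mul_mul_mul_comm, Real.mul_self_sqrt (prod_weight_nonneg hw x)]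
  simp only [mul_pow, Real.sq_sqrt (prod_weight_nonneg hw _), e] at h
  exact h

theorem prodExp_abs_le_sqrt (hw : IsWeight w) (F : (Fin m → α) → ℝ) :
    prodExp w (fun x => |F x|) ≤ √(prodExp w fun x => F x ^ 2) := by
  have h := prodExp_mul_le_sqrt hw (fun x => |F x|) (fun _ => 1)
  simpa [prodExp_const hw] using h

theorem prodExp_comp_fst_mul_comp_snd (F G : (Fin m → α) → ℝ) :
    prodExp (pairWeight w) (fun z => F (fun j => (z j).1) * G (fun j => (z j).2)) =
      prodExp w F * prodExp w G := by
  unfold prodExp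
  rw [Finset.sum_mul_sum, ← Fintype.sum_prod_type',
    ← (Equiv.arrowProdEquivProdArrow (Fin m) (fun _ => α) (fun _ => α)).sum_comp]
  refine Finset.sum_congr rfl fun z _ => ?_
  simp only [pairWeight, Finset.prod_mul_distrib, Equiv.arrowProdEquivProdArrow, Equiv.coe_fn_mk]
  ring

theorem prodExp_comp_fst (hw : IsWeight w) (F : (Fin m → α) → ℝ) :
    prodExp (pairWeight w) (fun z => F (fun j => (z j).1)) = prodExp w F := by
  simpa [prodExp_const hw] using prodExp_comp_fst_mul_comp_snd (w := w) F (fun _ => 1)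

theorem prodExp_comp_swapAt (j : Fin m) (F : (Fin m → α × α) → ℝ) :
    prodExp (pairWeight w) (fun z => F (swapAt j z)) = prodExp (pairWeight w) F := by
  have hinv : Function.Involutive (swapAt j : (Fin m → α × α) → _) := fun z => by
    funext i; by_cases h : i = j <;> simp [swapAt, h]
  unfold prodExp
  rw [← hinv.bijective.sum_comp (fun z => (∏ i, pairWeight w (z i)) * F z)]
  refine Finset.sum_congr rfl fun z _ => ?_
  congr 1
  refine Finset.prod_congr rfl fun i _ => ?_
  by_cases h : i = j <;> simp [swapAt, h, pairWeight, mul_comm]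

/-- An antisymmetric factor may be symmetrised. -/
theorem prodExp_fst_mul_of_antisymm (g : (Fin m → α) → ℝ) (j : Fin m)
    (D : (Fin m → α × α) → ℝ) (hD : ∀ z, D (swapAt j z) = -D z) :
    prodExp (pairWeight w) (fun z => resampleDiff g j z * D z) =
      2 * prodExp (pairWeight w) (fun z => g (fun i => (z i).1) * D z) := by
  have h := prodExp_comp_swapAt (w := w) j (fun z => g (fun i => (z i).1) * D z)
  simp only [hD, fst_swapAt] at h
  have e : (fun z : Fin m → α × α => resampleDiff g j z * D z) =
      fun z => g (fun i => (z i).1) * D z + g (resample j z) * -D z := by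
    funext z; simp only [resampleDiff]; ring
  rw [e, prodExp_add, h]
  ring

/-- Each `hybridDiff h j` is antisymmetric under `swapAt j`, so symmetrisation leaves `2 g(x) ·
hybridDiff h j`. The sum over `j` telescopes to `h(x) - h(x')` with `x'` independent of `x`. -/
theorem prodExp_sum_resampleDiff_mul_hybridDiff (hw : IsWeight w) (g h : (Fin m → α) → ℝ) :
    prodExp (pairWeight w) (fun z => ∑ j, resampleDiff g j z * hybridDiff h j z) =
      2 * (prodExp w (fun x => g x * h x) - prodExp w g * prodExp w h) := by
  rw [prodExp_sum]
  simp_rw [fun j => prodExp_fst_mul_of_antisymm (w := w) g j (hybridDiff h j)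
    (hybridDiff_swapAt h j)]
  rw [← Finset.mul_sum, ← prodExp_sum]
  congr 1
  simp_rw [← Finset.mul_sum, sum_hybridDiff, mul_sub]
  rw [prodExp_sub, prodExp_comp_fst hw (fun x => g x * h x), prodExp_comp_fst_mul_comp_snd]

/-- A form of the Efron–Stein inequality: the variance is controlled by one-coordinate changes. -/
theorem prodExp_sq_sub_le (hw : IsWeight w) (h : (Fin m → α) → ℝ) :
    prodExp w (fun x => (h x - prodExp w h) ^ 2) ≤
      (1 / 4) * prodExp (pairWeight w)
        (fun z => ∑ j, resampleDiff h j z ^ 2 + ∑ j, hybridDiff h j z ^ 2) := by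
  have e := prodExp_sum_resampleDiff_mul_hybridDiff hw h h
  have e1 : prodExp w (fun x => (h x - prodExp w h) ^ 2) =
      prodExp w (fun x => h x * h x) - prodExp w h * prodExp w h := by
    have : (fun x => (h x - prodExp w h) ^ 2) =
        fun x => (h x * h x - (2 * prodExp w h) * h x) + prodExp w h ^ 2 := by
      funext x; ring
    rw [this, prodExp_add, prodExp_sub, prodExp_const_mul, prodExp_const hw]
    ring
  have e2 : prodExp (pairWeight w) (fun z => ∑ j, resampleDiff h j z * hybridDiff h j z) ≤
      prodExp (pairWeight w) (fun z => (1 / 2) *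
        (∑ j, resampleDiff h j z ^ 2 + ∑ j, hybridDiff h j z ^ 2)) := by
    refine prodExp_mono hw.pairWeight fun z => ?_
    rw [← Finset.sum_add_distrib, Finset.mul_sum]
    exact Finset.sum_le_sum fun j _ => by
      nlinarith [sq_nonneg (resampleDiff h j z - hybridDiff h j z)]
  rw [prodExp_const_mul] at e2
  linarith

end ProductExpectation

end Occupancy

/-! ### The Stein equation for half lines and the regularity of its solution. -/

namespace NormalStein

/-- The standard normal density. -/
noncomputable def pdf (x : ℝ) : ℝ := gaussianPDFReal 0 1 x

/-- The standard normal distribution function. -/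
noncomputable def cdf (x : ℝ) : ℝ := (gaussianReal 0 1).real (Set.Iic x)

theorem pdf_eq (x : ℝ) : pdf x = (√(2 * Real.pi))⁻¹ * Real.exp (-x ^ 2 / 2) := by
  simp [pdf, gaussianPDFReal]

theorem pdf_pos (x : ℝ) : 0 < pdf x := gaussianPDFReal_pos _ _ _ one_ne_zero

theorem continuous_pdf : Continuous pdf := by
  have : pdf = fun x => (√(2 * Real.pi))⁻¹ * Real.exp (-x ^ 2 / 2) := funext pdf_eq
  rw [this]; fun_prop

theorem integrable_pdf : Integrable pdf := integrable_gaussianPDFReal 0 1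

theorem hasDerivAt_pdf (x : ℝ) : HasDerivAt pdf (-x * pdf x) x := by
  have e : pdf = fun x => (√(2 * Real.pi))⁻¹ * Real.exp (-x ^ 2 / 2) := funext pdf_eq
  have h : HasDerivAt (fun x : ℝ => -x ^ 2 / 2) (-x) x := by
    have := (((hasDerivAt_id x).pow 2).neg.div_const 2)
    exact this.congr_deriv (by simp; ring)
  rw [pdf_eq, e]
  exact (h.exp.const_mul (√(2 * Real.pi))⁻¹).congr_deriv (by ring)

theorem cdf_nonneg (x : ℝ) : 0 ≤ cdf x := measureReal_nonneg

theorem cdf_le_one (x : ℝ) : cdf x ≤ 1 := measureReal_le_one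

theorem cdf_mono : Monotone cdf := fun _ _ h => measureReal_mono (Set.Iic_subset_Iic.2 h)

theorem real_eq_integral (s : Set ℝ) :
    (gaussianReal 0 1).real s = ∫ x in s, pdf x := by
  rw [measureReal_def, gaussianReal_apply_eq_integral 0 one_ne_zero,
    ENNReal.toReal_ofReal]
  · rfl
  · exact integral_nonneg fun x => (pdf_pos x).le

theorem cdf_eq_integral (x : ℝ) : cdf x = ∫ y in Set.Iic x, pdf y := real_eq_integral _

theorem hasDerivAt_cdf (x : ℝ) : HasDerivAt cdf (pdf x) x := by
  have e : cdf = fun x => cdf 0 + ∫ y in (0 : ℝ)..x, pdf y := by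
    funext x
    rw [cdf_eq_integral, cdf_eq_integral,
      ← intervalIntegral.integral_Iic_sub_Iic integrable_pdf.integrableOn
        integrable_pdf.integrableOn]
    ring
  rw [e]
  exact (intervalIntegral.integral_hasDerivAt_right (integrable_pdf.intervalIntegrable)
    (continuous_pdf.stronglyMeasurableAtFilter _ _) continuous_pdf.continuousAt).const_add _

theorem cdf_neg (x : ℝ) : cdf (-x) = 1 - cdf x := by
  have h1 : 1 - cdf x = (gaussianReal 0 1).real (Set.Ioi x) := by
    rw [← Set.compl_Iic, probReal_compl_eq_one_sub measurableSet_Iic]; rfl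
  have h := integral_comp_neg_Iic (-x) pdf
  rw [h1, real_eq_integral, cdf_eq_integral]
  rw [neg_neg] at h
  rw [← h]
  congr 1
  funext y
  simp [pdf_eq]

/-- Mills' inequality: for `y ≤ x` one has `-x ≤ -y`, and `-y * pdf y` is the derivative of `pdf`.
-/
theorem neg_mul_cdf_le (x : ℝ) : -x * cdf x ≤ pdf x := by
  have hint : Integrable (fun y : ℝ => -y * pdf y) := by
    have := (integrable_mul_exp_neg_mul_sq (b := 1 / 2) (by norm_num)).const_mul
      (-(√(2 * Real.pi))⁻¹)
    convert this using 2 with y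
    rw [pdf_eq]
    have : -y ^ 2 / 2 = -(1 / 2) * y ^ 2 := by ring
    rw [this]; ring
  have hlim : Filter.Tendsto pdf Filter.atBot (nhds 0) := by
    have e : pdf = fun x => (√(2 * Real.pi))⁻¹ * Real.exp (-x ^ 2 / 2) := funext pdf_eq
    have h : Filter.Tendsto (fun x : ℝ => -x ^ 2 / 2) Filter.atBot Filter.atBot := by
      have : (fun x : ℝ => -x ^ 2 / 2) = fun x => -(x ^ 2 / 2) := by funext x; ring
      rw [this]
      exact Filter.tendsto_neg_atTop_atBot.comp
        ((Filter.Tendsto.atTop_div_const (r := 2) (by norm_num)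
          (Filter.Tendsto.comp (Filter.tendsto_pow_atTop two_ne_zero)
            Filter.tendsto_abs_atBot_atTop)).congr fun x => by simp [sq_abs])
    rw [e, ← mul_zero (√(2 * Real.pi))⁻¹]
    exact (Real.tendsto_exp_atBot.comp h).const_mul _
  have hI := integral_Iic_of_hasDerivAt_of_tendsto' (a := x) (fun y _ => hasDerivAt_pdf y)
    hint.integrableOn hlim
  rw [sub_zero] at hI
  rw [← hI, cdf_eq_integral, ← integral_const_mul]
  refine setIntegral_mono_on (integrable_pdf.integrableOn.const_mul _) hint.integrableOn
    measurableSet_Iic fun y hy => ?_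
  have : y ≤ x := hy
  exact mul_le_mul_of_nonneg_right (by linarith) (pdf_pos y).le

theorem mul_one_sub_cdf_le (x : ℝ) : x * (1 - cdf x) ≤ pdf x := by
  have h := neg_mul_cdf_le (-x)
  rw [cdf_neg, neg_neg] at h
  simpa [pdf_eq] using h

/-- The bounded solution of the Stein equation for the half line `(-∞, t]`. -/
noncomputable def sol (t w : ℝ) : ℝ := (cdf (min w t) - cdf w * cdf t) / pdf w

/-- The derivative of `sol t`, with a convention at `t`. -/
noncomputable def solDeriv (t w : ℝ) : ℝ :=
  w * sol t w + ((if w ≤ t then 1 else 0) - cdf t)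

theorem numerator_nonneg (t w : ℝ) : 0 ≤ cdf (min w t) - cdf w * cdf t := by
  rcases le_total w t with h | h
  · rw [min_eq_left h]; nlinarith [cdf_nonneg w, cdf_le_one t]
  · rw [min_eq_right h]; nlinarith [cdf_nonneg t, cdf_le_one w]

theorem numerator_le_cdf (t w : ℝ) : cdf (min w t) - cdf w * cdf t ≤ cdf w := by
  have := cdf_mono (min_le_left w t)
  nlinarith [cdf_nonneg w, cdf_nonneg t]

theorem numerator_le_one_sub_cdf (t w : ℝ) :
    cdf (min w t) - cdf w * cdf t ≤ 1 - cdf w := by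
  have h0 := cdf_le_one w
  have h1 := cdf_le_one t
  have h2 := cdf_mono (min_le_right w t)
  nlinarith

theorem sol_nonneg (t w : ℝ) : 0 ≤ sol t w := div_nonneg (numerator_nonneg t w) (pdf_pos w).le

theorem abs_mul_sol_le (t w : ℝ) : |w * sol t w| ≤ 1 := by
  rw [abs_mul, abs_of_nonneg (sol_nonneg t w), sol, ← mul_div_assoc, div_le_one (pdf_pos w)]
  rcases le_total 0 w with h | h
  · rw [abs_of_nonneg h]
    exact (mul_le_mul_of_nonneg_left (numerator_le_one_sub_cdf t w) h).trans
      (mul_one_sub_cdf_le w)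
  · rw [abs_of_nonpos h]
    exact (mul_le_mul_of_nonneg_left (numerator_le_cdf t w) (by linarith)).trans
      (neg_mul_cdf_le w)

theorem abs_sol_le (t w : ℝ) : |sol t w| ≤ 9 := by
  rcases le_total 1 |w| with h | h
  · have := abs_mul_sol_le t w
    rw [abs_mul] at this
    nlinarith [abs_nonneg (sol t w)]
  -- For `|w| ≤ 1` the density is at least `1/9`: both `(√(2π))⁻¹` and `exp (-1)` are at least
  -- `1/3`.
  · rw [abs_of_nonneg (sol_nonneg t w), sol, div_le_iff₀ (pdf_pos w), pdf_eq]
    have h1 := (numerator_le_cdf t w).trans (cdf_le_one w)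
    have hw : w ^ 2 ≤ 1 := by rw [← sq_abs]; nlinarith [abs_nonneg w]
    have h2 : Real.exp (-1 : ℝ) ≤ Real.exp (-w ^ 2 / 2) := Real.exp_le_exp.2 (by nlinarith)
    have h3 : (1 : ℝ) / 3 ≤ Real.exp (-1 : ℝ) := by
      rw [Real.exp_neg, ← one_div]
      exact one_div_le_one_div_of_le (Real.exp_pos _) (by linarith [Real.exp_one_lt_d9])
    have h4 : √(2 * Real.pi) ≤ 3 := by
      rw [Real.sqrt_le_left (by norm_num)]
      linarith [Real.pi_lt_d2]
    have h5 : (1 : ℝ) / 3 ≤ (√(2 * Real.pi))⁻¹ := by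
      rw [← one_div]
      exact one_div_le_one_div_of_le (by positivity) h4
    nlinarith [mul_le_mul h5 (h3.trans h2) (by norm_num) (by positivity)]

theorem abs_solDeriv_le (t w : ℝ) : |solDeriv t w| ≤ 2 := by
  have h1 : |((if w ≤ t then 1 else 0) - cdf t : ℝ)| ≤ 1 := by
    rw [abs_le]
    split_ifs <;> constructor <;> linarith [cdf_nonneg t, cdf_le_one t]
  have h2 := abs_mul_sol_le t w
  have h3 := abs_add_le (w * sol t w) ((if w ≤ t then 1 else 0) - cdf t)
  unfold solDeriv
  linarith

/-- Since `pdf' = -w * pdf`, dividing by `pdf` produces the term `w * f w` of the Stein equation. -/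
theorem hasDerivAt_div_pdf {A : ℝ → ℝ} {A' w : ℝ} (hA : HasDerivAt A (A' * pdf w) w) :
    HasDerivAt (fun x => A x / pdf x) (A' + w * (A w / pdf w)) w := by
  refine (hA.div (hasDerivAt_pdf w) (pdf_pos w).ne').congr_deriv ?_
  have := (pdf_pos w).ne'
  field_simp
  ring

/-- Subtracting `min w t` removes the kink of `sol t` at `t`. -/
theorem hasDerivAt_sol_sub_min (t w : ℝ) :
    HasDerivAt (fun x => sol t x - min x t) (w * sol t w - cdf t) w := by
  have hl : ∀ x, HasDerivAt (fun x => (cdf x - cdf x * cdf t) / pdf x - x)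
      (x * ((cdf x - cdf x * cdf t) / pdf x) - cdf t) x := fun x => by
    have h : HasDerivAt (fun x => cdf x - cdf x * cdf t) ((1 - cdf t) * pdf x) x := by
      exact ((hasDerivAt_cdf x).sub ((hasDerivAt_cdf x).mul_const (cdf t))).congr_deriv (by ring)
    exact ((hasDerivAt_div_pdf h).sub (hasDerivAt_id x)).congr_deriv (by ring)
  have hr : ∀ x, HasDerivAt (fun x => (cdf t - cdf x * cdf t) / pdf x - t)
      (x * ((cdf t - cdf x * cdf t) / pdf x) - cdf t) x := fun x => by
    have h : HasDerivAt (fun x => cdf t - cdf x * cdf t) ((- cdf t) * pdf x) x := by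
      exact (((hasDerivAt_cdf x).mul_const (cdf t)).const_sub (cdf t)).congr_deriv (by ring)
    exact ((hasDerivAt_div_pdf h).sub_const t).congr_deriv (by ring)
  have el : ∀ x, x ≤ t → sol t x = (cdf x - cdf x * cdf t) / pdf x := fun x hx => by
    rw [sol, min_eq_left hx]
  have er : ∀ x, t ≤ x → sol t x = (cdf t - cdf x * cdf t) / pdf x := fun x hx => by
    rw [sol, min_eq_right hx]
  have wl : ∀ x ≤ t, HasDerivWithinAt (fun x => sol t x - min x t) (x * sol t x - cdf t)
      (Set.Iic t) x := fun x hx => by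
    rw [el x hx]
    exact (hl x).hasDerivWithinAt.congr (fun y hy => by rw [el y hy, min_eq_left hy])
      (by rw [el x hx, min_eq_left hx])
  have wr : ∀ x, t ≤ x → HasDerivWithinAt (fun x => sol t x - min x t) (x * sol t x - cdf t)
      (Set.Ici t) x := fun x hx => by
    rw [er x hx]
    exact (hr x).hasDerivWithinAt.congr (fun y hy => by rw [er y hy, min_eq_right hy])
      (by rw [er x hx, min_eq_right hx])
  rcases lt_trichotomy w t with h | h | h
  · exact (wl w h.le).hasDerivAt (Iic_mem_nhds h)
  · subst h
    have := (wl w le_rfl).union (wr w le_rfl)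
    rwa [Set.Iic_union_Ici, hasDerivWithinAt_univ] at this
  · exact (wr w h.le).hasDerivAt (Ici_mem_nhds h)

theorem exists_sol_sub_min_sub_eq (t a b : ℝ) :
    ∃ ξ ∈ Set.uIcc a b, (sol t a - min a t) - (sol t b - min b t) =
      (ξ * sol t ξ - cdf t) * (a - b) := by
  have hc : Continuous (fun x => sol t x - min x t) :=
    continuous_iff_continuousAt.2 fun x => (hasDerivAt_sol_sub_min t x).continuousAt
  rcases lt_trichotomy a b with h | h | h
  · obtain ⟨ξ, hξ, e⟩ := exists_hasDerivAt_eq_slope _ _ h hc.continuousOn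
      (fun x _ => hasDerivAt_sol_sub_min t x)
    refine ⟨ξ, Set.Icc_subset_uIcc (Set.Ioo_subset_Icc_self hξ), ?_⟩
    rw [e]; field_simp [(sub_pos.2 h).ne']; ring
  · exact ⟨a, Set.left_mem_uIcc, by simp [h]⟩
  · obtain ⟨ξ, hξ, e⟩ := exists_hasDerivAt_eq_slope _ _ h hc.continuousOn
      (fun x _ => hasDerivAt_sol_sub_min t x)
    refine ⟨ξ, Set.Icc_subset_uIcc' (Set.Ioo_subset_Icc_self hξ), ?_⟩
    rw [e]; field_simp [(sub_pos.2 h).ne']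

/-- Both sides vanish unless `t` separates `a` and `b`. The bound is kept linear in the difference
of indicators, without absolute values, so that it can later be symmetrised. -/
theorem abs_min_sub_min_sub_le (t a b : ℝ) :
    |min a t - min b t - (a - b) * (if a ≤ t then 1 else 0)| ≤
      (a - b) * ((if b ≤ t then 1 else 0) - (if a ≤ t then 1 else 0)) := by
  rw [abs_le]
  split_ifs with h1 h2 h2 <;> constructor <;>
    simp only [min_def] <;> split_ifs <;> linarith

theorem abs_sol_sub_sol_le (t a b : ℝ) : |sol t a - sol t b| ≤ 3 * |a - b| := by
  obtain ⟨ξ, -, e⟩ := exists_sol_sub_min_sub_eq t a b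
  have e' : sol t a - sol t b = (ξ * sol t ξ - cdf t) * (a - b) + (min a t - min b t) := by
    linarith
  have h1 : |min a t - min b t| ≤ |a - b| := by
    simpa using abs_min_sub_min_le_max a t b t
  have h2 : |ξ * sol t ξ - cdf t| ≤ 2 := by
    have := abs_sub (ξ * sol t ξ) (cdf t)
    rw [abs_of_nonneg (cdf_nonneg t)] at this
    linarith [abs_mul_sol_le t ξ, cdf_le_one t]
  rw [e']
  refine (abs_add_le _ _).trans ?_
  rw [abs_mul]
  nlinarith [abs_nonneg (a - b)]

/-- The part without kink is handled by the mean value theorem and the local Lipschitz bound for `x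
* sol t x`; the kink contributes the indicator term. -/
theorem abs_sol_sub_sol_sub_le (t a b : ℝ) :
    |sol t a - sol t b - (a - b) * solDeriv t a| ≤ (a - b) ^ 2 * (3 * |a| + 9) +
      (a - b) * ((if b ≤ t then 1 else 0) - (if a ≤ t then 1 else 0)) := by
  obtain ⟨ξ, hξ, e⟩ := exists_sol_sub_min_sub_eq t a b
  have hξ' : |ξ - a| ≤ |a - b| := by
    rw [abs_sub_comm a b]; exact Set.abs_sub_left_of_mem_uIcc hξ
  have e' : sol t a - sol t b - (a - b) * solDeriv t a =
      (ξ * sol t ξ - a * sol t a) * (a - b) +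
        (min a t - min b t - (a - b) * (if a ≤ t then 1 else 0)) := by
    unfold solDeriv
    linarith
  have h1 : |ξ * sol t ξ - a * sol t a| ≤ |a - b| * (3 * |a| + 9) := by
    have e2 : ξ * sol t ξ - a * sol t a = (ξ - a) * sol t ξ + a * (sol t ξ - sol t a) := by ring
    rw [e2]
    refine (abs_add_le _ _).trans ?_
    rw [abs_mul, abs_mul]
    have h3 := mul_le_mul hξ' (abs_sol_le t ξ) (abs_nonneg _) (abs_nonneg _)
    have h4 := mul_le_mul_of_nonneg_left
      ((abs_sol_sub_sol_le t ξ a).trans (mul_le_mul_of_nonneg_left hξ' zero_le_three))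
      (abs_nonneg a)
    linarith
  rw [e']
  refine (abs_add_le _ _).trans (add_le_add ?_ (abs_min_sub_min_sub_le t a b))
  rw [abs_mul, ← sq_abs (a - b)]
  nlinarith [abs_nonneg (a - b)]

end NormalStein

/-! ### Locality: the effect of one ball, bounded by loads of urns. -/

namespace Occupancy

section Locality

variable {m n : ℕ}

/-- The number of balls in urn `a` of the configuration `x`. -/
def occ (x : Fin m → Fin n) (a : Fin n) : ℕ := (Finset.univ.filter fun j => x j = a).card

/-- The additive functional of a configuration. -/
def functional (φ : Fin n → ℕ → ℝ) (x : Fin m → Fin n) : ℝ := ∑ i, φ i (occ x i)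

/-- The number of balls to which the urn `a` is available. -/
def load (S : Fin m → Finset (Fin n)) (a : Fin n) : ℕ :=
  (Finset.univ.filter fun j => a ∈ S j).card

/-- The sum of the exponential loads. -/
noncomputable def expLoad (S : Fin m → Finset (Fin n)) (L : ℝ) : ℝ :=
  ∑ a, Real.exp (L * load S a)

/-- The sum of the exponential loads of the urns available to the `j`-th ball. -/
noncomputable def localLoad (S : Fin m → Finset (Fin n)) (L : ℝ) (j : Fin m) : ℝ :=
  ∑ a ∈ S j, Real.exp (L * load S a)

variable {S : Fin m → Finset (Fin n)} {x y x' y' : Fin m → Fin n} {φ : Fin n → ℕ → ℝ} {K : ℝ}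

theorem occ_le_load (hx : ∀ j, x j ∈ S j) (a : Fin n) : occ x a ≤ load S a := by
  refine Finset.card_le_card fun j hj => ?_
  simp only [Finset.mem_filter, Finset.mem_univ, true_and] at hj ⊢
  exact hj ▸ hx j

theorem occ_congr {j : Fin m} (h : ∀ i, i ≠ j → x i = y i) {a : Fin n} {B : Finset (Fin n)}
    (ha : a ∉ B) (hx : x j ∈ B) (hy : y j ∈ B) : occ x a = occ y a := by
  have hx : x j ≠ a := fun e => ha (e ▸ hx)
  have hy : y j ≠ a := fun e => ha (e ▸ hy)
  unfold occ
  congr 1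
  ext i
  simp only [Finset.mem_filter, Finset.mem_univ, true_and]
  by_cases hi : i = j
  · subst hi; simp [hx, hy]
  · rw [h i hi]

theorem abs_functional_sub_le (hK : 0 < K) (hφ : ∀ i k, |φ i k| ≤ K * Real.exp (K * (k : ℕ)))
    {j : Fin m} (hx : ∀ i, x i ∈ S i) (hy : ∀ i, y i ∈ S i) (h : ∀ i, i ≠ j → x i = y i) :
    |functional φ x - functional φ y| ≤ 2 * K * localLoad S K j := by
  have hb : ∀ z : Fin m → Fin n, (∀ i, z i ∈ S i) → ∀ a,
      |φ a (occ z a)| ≤ K * Real.exp (K * load S a) := fun z hz a => by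
    refine (hφ _ _).trans ?_
    have : (occ z a : ℝ) ≤ load S a := by exact_mod_cast occ_le_load hz a
    gcongr
  unfold functional localLoad
  rw [← Finset.sum_sub_distrib, Finset.mul_sum]
  rw [← Finset.sum_subset (Finset.subset_univ (S j)) fun a _ ha => by
    rw [occ_congr h ha (hx j) (hy j), sub_self]]
  refine (Finset.abs_sum_le_sum_abs _ _).trans (Finset.sum_le_sum fun a _ => ?_)
  refine (abs_sub _ _).trans ?_
  linarith [hb x hx a, hb y hy a]

/-- The mixed second difference vanishes: no single urn sees both ball `i` and ball `j`. -/
theorem functional_sub_congr {i j : Fin m} (hS : Disjoint (S i) (S j))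
    (hx : ∀ k, x k ∈ S k) (hy : ∀ k, y k ∈ S k) (hx' : ∀ k, x' k ∈ S k) (hy' : ∀ k, y' k ∈ S k)
    (hxy : ∀ k, k ≠ j → x k = y k) (hxy' : ∀ k, k ≠ j → x' k = y' k)
    (hxx : ∀ k, k ≠ i → x k = x' k) (hyy : ∀ k, k ≠ i → y k = y' k) :
    functional φ x - functional φ y = functional φ x' - functional φ y' := by
  unfold functional
  rw [← Finset.sum_sub_distrib, ← Finset.sum_sub_distrib]
  refine Finset.sum_congr rfl fun a _ => ?_
  by_cases ha : a ∈ S j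
  · have ha' : a ∉ S i := fun h => Finset.disjoint_left.1 hS h ha
    rw [occ_congr hxx ha' (hx i) (hx' i),
      occ_congr hyy ha' (hy i) (hy' i)]
  · rw [occ_congr hxy ha (hx j) (hy j),
      occ_congr hxy' ha (hx' j) (hy' j), sub_self, sub_self]

variable {z z' : Fin m → Fin n × Fin n}

theorem hybrid_mem (hz : ∀ j, (z j).1 ∈ S j ∧ (z j).2 ∈ S j) (k : ℕ) (j : Fin m) :
    hybrid k z j ∈ S j := by
  unfold hybrid; split_ifs
  exacts [(hz j).2, (hz j).1]

theorem resample_mem (hz : ∀ j, (z j).1 ∈ S j ∧ (z j).2 ∈ S j) (k j : Fin m) :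
    resample k z j ∈ S j := by
  unfold resample; split_ifs
  exacts [(hz j).2, (hz j).1]

theorem hybrid_succ_agree {α : Type*} (z : Fin m → α × α) (j : Fin m) :
    ∀ k, k ≠ j → hybrid j z k = hybrid (j + 1) z k := fun k hk => by
  have h' : (k : ℕ) ≠ j := fun e => hk (Fin.ext e)
  have : (k : ℕ) < j + 1 ↔ (k : ℕ) < j := by omega
  simp [hybrid, this]

theorem resample_agree {α : Type*} (z : Fin m → α × α) (j : Fin m) :
    ∀ k, k ≠ j → (z k).1 = resample j z k := fun k hk => by simp [resample, hk]

theorem hybrid_congr {α : Type*} {z z' : Fin m → α × α} {i : Fin m}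
    (h : ∀ k, k ≠ i → z k = z' k) (l : ℕ) :
    ∀ k, k ≠ i → hybrid l z k = hybrid l z' k := fun k hk => by simp [hybrid, h k hk]

theorem resample_congr {α : Type*} {z z' : Fin m → α × α} {i : Fin m}
    (h : ∀ k, k ≠ i → z k = z' k) (l : Fin m) :
    ∀ k, k ≠ i → resample l z k = resample l z' k := fun k hk => by simp [resample, h k hk]

theorem abs_resampleDiff_functional_le (hK : 0 < K)
    (hφ : ∀ i k, |φ i k| ≤ K * Real.exp (K * (k : ℕ)))
    (hz : ∀ j, (z j).1 ∈ S j ∧ (z j).2 ∈ S j) (j : Fin m) :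
    |resampleDiff (functional φ) j z| ≤ 2 * K * localLoad S K j :=
  abs_functional_sub_le hK hφ (fun i => (hz i).1) (resample_mem hz j) (resample_agree z j)

theorem abs_hybridDiff_functional_le (hK : 0 < K)
    (hφ : ∀ i k, |φ i k| ≤ K * Real.exp (K * (k : ℕ)))
    (hz : ∀ j, (z j).1 ∈ S j ∧ (z j).2 ∈ S j) (j : Fin m) :
    |hybridDiff (functional φ) j z| ≤ 2 * K * localLoad S K j :=
  abs_functional_sub_le hK hφ (hybrid_mem hz _) (hybrid_mem hz _) (hybrid_succ_agree z j)

/-- A sum over the balls of a function of the two differences. -/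
noncomputable def diffSum (φ : Fin n → ℕ → ℝ) (τ : ℝ → ℝ → ℝ) (z : Fin m → Fin n × Fin n) : ℝ :=
  ∑ j, τ (resampleDiff (functional φ) j z) (hybridDiff (functional φ) j z)

/-- A bound for the effect on `diffSum` of a change of the `i`-th pair. -/
noncomputable def interaction (S : Fin m → Finset (Fin n)) (K : ℝ) (i : Fin m) : ℝ :=
  ∑ j with ¬Disjoint (S i) (S j), 2 * (2 * K * localLoad S K j) ^ 2

/-- By `functional_sub_congr` only the summands `j` whose urns meet `S i` change. Here `S` must
contain the entries of both `z` and `z'`. -/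
theorem abs_diffSum_sub_le (hK : 0 < K) (hφ : ∀ i k, |φ i k| ≤ K * Real.exp (K * (k : ℕ)))
    {τ : ℝ → ℝ → ℝ} (hτ : ∀ a b, |τ a b| ≤ |a| * |b|)
    (hz : ∀ j, (z j).1 ∈ S j ∧ (z j).2 ∈ S j) (hz' : ∀ j, (z' j).1 ∈ S j ∧ (z' j).2 ∈ S j)
    {i : Fin m} (h : ∀ k, k ≠ i → z k = z' k) :
    |diffSum φ τ z - diffSum φ τ z'| ≤ interaction S K i := by
  have hb : ∀ z : Fin m → Fin n × Fin n, (∀ j, (z j).1 ∈ S j ∧ (z j).2 ∈ S j) → ∀ j,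
      |τ (resampleDiff (functional φ) j z) (hybridDiff (functional φ) j z)| ≤
        (2 * K * localLoad S K j) ^ 2 := fun z hz j => by
    refine (hτ _ _).trans ?_
    rw [sq]
    exact mul_le_mul (abs_resampleDiff_functional_le hK hφ hz j)
      (abs_hybridDiff_functional_le hK hφ hz j) (abs_nonneg _)
      ((abs_nonneg _).trans (abs_resampleDiff_functional_le hK hφ hz j))
  unfold diffSum interaction
  rw [← Finset.sum_sub_distrib]
  rw [← Finset.sum_subset (Finset.filter_subset (fun j => ¬Disjoint (S i) (S j)) _) fun j _ hj => by
    have hd : Disjoint (S i) (S j) := by simpa using hj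
    have e1 : resampleDiff (functional φ) j z = resampleDiff (functional φ) j z' :=
      functional_sub_congr hd (fun k => (hz k).1) (resample_mem hz j) (fun k => (hz' k).1)
        (resample_mem hz' j) (resample_agree z j) (resample_agree z' j)
        (fun k hk => by rw [h k hk]) (resample_congr h j)
    have e2 : hybridDiff (functional φ) j z = hybridDiff (functional φ) j z' :=
      functional_sub_congr hd (hybrid_mem hz _) (hybrid_mem hz _) (hybrid_mem hz' _)
        (hybrid_mem hz' _) (hybrid_succ_agree z j) (hybrid_succ_agree z' j)
        (hybrid_congr h _) (hybrid_congr h _)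
    rw [e1, e2, sub_self]]
  refine (Finset.abs_sum_le_sum_abs _ _).trans (Finset.sum_le_sum fun j _ => ?_)
  refine (abs_sub _ _).trans ?_
  linarith [hb z hz j, hb z' hz' j]

theorem localLoad_nonneg (L : ℝ) (j : Fin m) : 0 ≤ localLoad S L j :=
  Finset.sum_nonneg fun _ _ => (Real.exp_pos _).le

/-- Double counting of the pairs of a ball and an urn available to it. -/
theorem sum_sum_mem (f : Fin n → ℝ) : ∑ j, ∑ a ∈ S j, f a = ∑ a, load S a * f a := by
  have : ∀ j, ∑ a ∈ S j, f a = ∑ a, if a ∈ S j then f a else 0 := fun j => by simp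
  simp_rw [this]
  rw [Finset.sum_comm]
  refine Finset.sum_congr rfl fun a _ => ?_
  rw [← Finset.sum_filter, Finset.sum_const, nsmul_eq_mul, load]

theorem sum_localLoad_le (L : ℝ) : ∑ j, localLoad S L j ≤ expLoad S (L + 1) := by
  unfold localLoad expLoad
  rw [sum_sum_mem]
  refine Finset.sum_le_sum fun a _ => ?_
  rw [add_mul, one_mul, add_comm, Real.exp_add]
  gcongr
  linarith [Real.add_one_le_exp (load S a : ℝ)]

theorem localLoad_pow_le (hS : ∀ j, (S j).card ≤ 4) (L : ℝ) (j : Fin m) (k : ℕ) :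
    localLoad S L j ^ (k + 1) ≤ 4 ^ k * localLoad S ((k + 1) * L) j := by
  have h := pow_sum_div_card_le_sum_pow (s := S j)
    (f := fun a => Real.exp (L * load S a)) (fun _ _ => (Real.exp_pos _).le) k
  rcases (S j).eq_empty_or_nonempty with h0 | h0
  · simp [localLoad, h0]
  have hc : (0 : ℝ) < (S j).card := by exact_mod_cast h0.card_pos
  have hc4 : ((S j).card : ℝ) ≤ 4 := by exact_mod_cast hS j
  rw [div_le_iff₀' (by positivity)] at h
  have e : ∑ a ∈ S j, Real.exp (L * load S a) ^ (k + 1) = localLoad S ((k + 1) * L) j :=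
    Finset.sum_congr rfl fun a _ => by
      rw [← Real.exp_nat_mul]; congr 1; push_cast; ring
  rw [e] at h
  refine h.trans (mul_le_mul_of_nonneg_right (by gcongr) (Finset.sum_nonneg fun _ _ => ?_))
  exact (Real.exp_pos _).le

theorem localLoad_mono {L L' : ℝ} (h : L ≤ L') (j : Fin m) :
    localLoad S L j ≤ localLoad S L' j := by
  unfold localLoad
  gcongr

theorem sum_localLoad_pow_le (hS : ∀ j, (S j).card ≤ 4) (L : ℝ) (k : ℕ) :
    ∑ j, localLoad S L j ^ (k + 1) ≤ 4 ^ k * expLoad S ((k + 1) * L + 1) := by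
  refine (Finset.sum_le_sum fun j _ => localLoad_pow_le hS L j k).trans ?_
  rw [← Finset.mul_sum]
  gcongr
  exact sum_localLoad_le _

/-- Balls that interact share some urn `a`. Cauchy–Schwarz is applied over the at most four urns of
`S i` and then over the `load S a` balls that may use `a`. -/
theorem interaction_sq_le (hS : ∀ j, (S j).card ≤ 4) (i : Fin m) :
    interaction S K i ^ 2 ≤ 16 * ∑ a ∈ S i, (load S a : ℝ) *
      ∑ j with a ∈ S j, (2 * K * localLoad S K j) ^ 4 := by
  have h1 : interaction S K i ≤
      ∑ a ∈ S i, ∑ j with a ∈ S j, 2 * (2 * K * localLoad S K j) ^ 2 := by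
    unfold interaction
    simp_rw [Finset.sum_filter]
    rw [Finset.sum_comm]
    refine Finset.sum_le_sum fun j _ => ?_
    split_ifs with hd
    · exact Finset.sum_nonneg fun b _ => by split_ifs <;> positivity
    · obtain ⟨a, ha, ha'⟩ := Finset.not_disjoint_iff.1 hd
      refine le_trans ?_ (Finset.single_le_sum (f := fun a => if a ∈ S j then
        2 * (2 * K * localLoad S K j) ^ 2 else 0) (fun b _ => ?_) ha)
      · rw [if_pos ha']
      · split_ifs <;> positivity
  have h0 : 0 ≤ interaction S K i := Finset.sum_nonneg fun _ _ => by positivity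
  have h2 := pow_le_pow_left₀ h0 h1 2
  refine h2.trans (sq_sum_le_card_mul_sum_sq.trans ?_)
  have h3 : ((S i).card : ℝ) ≤ 4 := by exact_mod_cast hS i
  refine (mul_le_mul_of_nonneg_right h3 (Finset.sum_nonneg fun _ _ => sq_nonneg _)).trans ?_
  have h4 : ∀ a, (∑ j with a ∈ S j, 2 * (2 * K * localLoad S K j) ^ 2) ^ 2 ≤
      4 * ((load S a : ℝ) * ∑ j with a ∈ S j, (2 * K * localLoad S K j) ^ 4) := fun a => by
    refine sq_sum_le_card_mul_sum_sq.trans (le_of_eq ?_)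
    rw [load, mul_left_comm (4 : ℝ), Finset.mul_sum _ _ (4 : ℝ)]
    congr 1
    exact Finset.sum_congr rfl fun j _ => by ring
  refine (mul_le_mul_of_nonneg_left (Finset.sum_le_sum fun a _ => h4 a) (by norm_num)).trans ?_
  rw [← Finset.mul_sum]
  linarith

theorem sum_interaction_sq_le (hK : 0 < K) (hS : ∀ j, (S j).card ≤ 4) :
    ∑ i, interaction S K i ^ 2 ≤ 65536 * K ^ 4 * expLoad S (8 * K + 5) := by
  -- Summing over `i` by double counting gives a second factor `load S a`, hence the square.
  have h1 : ∑ i, interaction S K i ^ 2 ≤ 16 * ∑ j, (2 * K * localLoad S K j) ^ 4 *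
      ∑ a ∈ S j, (load S a : ℝ) ^ 2 := by
    refine (Finset.sum_le_sum fun i _ => interaction_sq_le hS i).trans (le_of_eq ?_)
    rw [← Finset.mul_sum, sum_sum_mem]
    congr 1
    simp_rw [Finset.sum_filter, Finset.mul_sum]
    rw [Finset.sum_comm]
    refine Finset.sum_congr rfl fun j _ => ?_
    rw [← Finset.sum_subset (Finset.subset_univ (S j)) fun a _ ha => by simp [ha]]
    exact Finset.sum_congr rfl fun a ha => by rw [if_pos ha]; ring
  have h2 : ∀ j, ∑ a ∈ S j, (load S a : ℝ) ^ 2 ≤ localLoad S 2 j := fun j => by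
    refine Finset.sum_le_sum fun a _ => ?_
    have : (load S a : ℝ) ≤ Real.exp (load S a) := by
      linarith [Real.add_one_le_exp (load S a : ℝ)]
    rw [two_mul, Real.exp_add, ← sq]
    gcongr
  have h3 : ∀ j, (2 * K * localLoad S K j) ^ 4 * ∑ a ∈ S j, (load S a : ℝ) ^ 2 ≤
      4096 * K ^ 4 * localLoad S (8 * K + 4) j := fun j => by
    have e1 := localLoad_pow_le hS K j 3
    have e2 := localLoad_pow_le hS (4 * K + 2) j 1
    have e3 := localLoad_mono (S := S) (L := 4 * K) (L' := 4 * K + 2) (by linarith) j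
    have e4 := (h2 j).trans
      (localLoad_mono (S := S) (L := 2) (L' := 4 * K + 2) (by linarith) j)
    have e5 : ((1 : ℕ) + 1 : ℝ) * (4 * K + 2) = 8 * K + 4 := by push_cast; ring
    have e6 : ((3 : ℕ) + 1 : ℝ) * K = 4 * K := by push_cast; ring
    rw [e5] at e2
    rw [e6] at e1
    have e7 : localLoad S K j ^ 4 * ∑ a ∈ S j, (load S a : ℝ) ^ 2 ≤
        256 * localLoad S (8 * K + 4) j := by
      calc localLoad S K j ^ 4 * ∑ a ∈ S j, (load S a : ℝ) ^ 2
          ≤ (64 * localLoad S (4 * K + 2) j) * localLoad S (4 * K + 2) j := by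
            refine mul_le_mul ?_ e4 (Finset.sum_nonneg fun _ _ => sq_nonneg _)
              (mul_nonneg (by norm_num) (localLoad_nonneg _ _))
            norm_num at e1
            linarith
        _ ≤ _ := by
            norm_num at e2
            nlinarith
    calc _ = 16 * K ^ 4 * (localLoad S K j ^ 4 * ∑ a ∈ S j, (load S a : ℝ) ^ 2) := by ring
      _ ≤ 16 * K ^ 4 * (256 * localLoad S (8 * K + 4) j) := by gcongr
      _ = _ := by ring
  have h4 := Finset.sum_le_sum fun j (_ : j ∈ Finset.univ) => h3 j
  rw [← Finset.mul_sum] at h4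
  have h5 := sum_localLoad_le (S := S) (8 * K + 4)
  have e8 : 8 * K + 4 + 1 = 8 * K + 5 := by ring
  rw [e8] at h5
  have h6 := mul_le_mul_of_nonneg_left h5 (show 0 ≤ 4096 * K ^ 4 by positivity)
  linarith

/-- The expected exponential loads are bounded when each urn is available with probability
`O(1 / m)`. -/
theorem prodExp_expLoad_le {β : Type*} [Fintype β] {v : β → ℝ} (hv : IsWeight v)
    (A : β → Finset (Fin n)) {q : ℝ} (hq : ∀ a, m * ∑ b, v b * (if a ∈ A b then 1 else 0) ≤ q)
    {L : ℝ} (hL : 0 ≤ L) :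
    prodExp v (fun u : Fin m → β => expLoad (fun j => A (u j)) L) ≤
      n * Real.exp (Real.exp L * q) := by
  unfold expLoad
  rw [prodExp_sum]
  have h : ∀ a : Fin n, prodExp v (fun u : Fin m → β =>
      Real.exp (L * load (fun j => A (u j)) a)) ≤ Real.exp (Real.exp L * q) := fun a => by
    -- The load is a sum of independent indicators, so its exponential is a product over the balls
    -- and the expectation is an `m`-th power.
    have e : ∀ u : Fin m → β, Real.exp (L * load (fun j => A (u j)) a) =
        ∏ j, (1 + (Real.exp L - 1) * (if a ∈ A (u j) then 1 else 0)) := fun u => by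
      have : ∀ j, (1 + (Real.exp L - 1) * (if a ∈ A (u j) then 1 else 0)) =
          if a ∈ A (u j) then Real.exp L else 1 := fun j => by split_ifs <;> ring
      simp_rw [this]
      rw [← Finset.prod_filter, Finset.prod_const, ← Real.exp_nat_mul, mul_comm, load]
    simp_rw [e]
    rw [prodExp_prod (fun b => 1 + (Real.exp L - 1) * (if a ∈ A b then 1 else 0))]
    set r := ∑ b, v b * (if a ∈ A b then 1 else 0) with hr
    have er : ∑ b, v b * (1 + (Real.exp L - 1) * (if a ∈ A b then 1 else 0)) =
        (Real.exp L - 1) * r + 1 := by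
      simp_rw [mul_add, mul_one, Finset.sum_add_distrib, hv.sum_eq_one, hr, Finset.mul_sum]
      rw [add_comm]
      congr 1
      exact Finset.sum_congr rfl fun b _ => by ring
    have hr0 : 0 ≤ r := Finset.sum_nonneg fun b _ =>
      mul_nonneg (hv.nonneg b) (by split_ifs <;> norm_num)
    have hL1 : 1 ≤ Real.exp L := Real.one_le_exp hL
    rw [er]
    have := pow_le_pow_left₀ (by nlinarith) (Real.add_one_le_exp ((Real.exp L - 1) * r)) m
    refine this.trans ?_
    rw [← Real.exp_nat_mul]
    refine Real.exp_le_exp.2 ?_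
    have h1 := hq a
    have h0 : 0 ≤ m * r := by positivity
    nlinarith [mul_le_mul_of_nonneg_left h1 (Real.exp_pos L).le]
  refine (Finset.sum_le_sum fun a _ => h a).trans (le_of_eq ?_)
  simp

end Locality

end Occupancy

/-! ### Moment bounds and the normal approximation on the configuration space. -/

namespace Occupancy

section NormalApproximation

variable {m n : ℕ} {p : Fin n → ℝ} {φ : Fin n → ℕ → ℝ} {K κ : ℝ}

/-- The urns which occur in a pair of pairs. -/
def urns (b : (Fin n × Fin n) × (Fin n × Fin n)) : Finset (Fin n) :=
  {b.1.1, b.1.2, b.2.1, b.2.2}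

theorem card_urns_le (b : (Fin n × Fin n) × (Fin n × Fin n)) : (urns b).card ≤ 4 :=
  Finset.card_le_four

theorem IsWeight.sum_pairWeight_mul_fst {α : Type*} [Fintype α] {w : α → ℝ} (hw : IsWeight w)
    (f : α → ℝ) : ∑ b, Occupancy.pairWeight w b * f b.1 = ∑ a, w a * f a := by
  simp only [Occupancy.pairWeight, Fintype.sum_prod_type]
  refine Finset.sum_congr rfl fun a _ => ?_
  rw [← Finset.sum_mul, ← Finset.mul_sum, hw.sum_eq_one, mul_one]

theorem IsWeight.sum_pairWeight_mul_snd {α : Type*} [Fintype α] {w : α → ℝ} (hw : IsWeight w)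
    (f : α → ℝ) : ∑ b, Occupancy.pairWeight w b * f b.2 = ∑ a, w a * f a := by
  simp only [Occupancy.pairWeight, Fintype.sum_prod_type_right]
  refine Finset.sum_congr rfl fun a _ => ?_
  rw [← Finset.sum_mul, ← Finset.sum_mul, hw.sum_eq_one, one_mul]

theorem sum_weight_mem_urns_le (hp : IsWeight p) (a : Fin n) :
    ∑ b, pairWeight (pairWeight p) b * (if a ∈ urns b then 1 else 0) ≤ 4 * p a := by
  have h : ∀ b : (Fin n × Fin n) × (Fin n × Fin n), (if a ∈ urns b then (1 : ℝ) else 0) ≤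
      (if b.1.1 = a then 1 else 0) + (if b.1.2 = a then 1 else 0) +
        (if b.2.1 = a then 1 else 0) + (if b.2.2 = a then 1 else 0) := fun b => by
    by_cases h1 : b.1.1 = a <;> by_cases h2 : b.1.2 = a <;> by_cases h3 : b.2.1 = a <;>
      by_cases h4 : b.2.2 = a <;>
      simp [urns, h1, h2, h3, h4, eq_comm (a := a)]; norm_num
  have hs : ∑ c, p c * (if c = a then 1 else 0) = p a := by simp
  refine (Finset.sum_le_sum fun b _ => mul_le_mul_of_nonneg_left (h b)
    (hp.pairWeight.pairWeight.nonneg b)).trans (le_of_eq ?_)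
  simp only [mul_add, Finset.sum_add_distrib]
  rw [hp.pairWeight.sum_pairWeight_mul_fst fun b => if b.1 = a then (1 : ℝ) else 0,
    hp.pairWeight.sum_pairWeight_mul_fst fun b => if b.2 = a then (1 : ℝ) else 0,
    hp.pairWeight.sum_pairWeight_mul_snd fun b => if b.1 = a then (1 : ℝ) else 0,
    hp.pairWeight.sum_pairWeight_mul_snd fun b => if b.2 = a then (1 : ℝ) else 0,
    hp.sum_pairWeight_mul_fst fun c => if c = a then (1 : ℝ) else 0,
    hp.sum_pairWeight_mul_snd fun c => if c = a then (1 : ℝ) else 0, hs]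
  ring

theorem prodExp_expLoad_urns_le (hp : IsWeight p) (hκ : ∀ a, m * p a ≤ κ) {L : ℝ} (hL : 0 ≤ L) :
    prodExp (pairWeight (pairWeight p))
      (fun q : Fin m → (Fin n × Fin n) × (Fin n × Fin n) => expLoad (fun j => urns (q j)) L) ≤
      n * Real.exp (Real.exp L * (4 * κ)) := by
  refine prodExp_expLoad_le hp.pairWeight.pairWeight urns (fun a => ?_) hL
  have := mul_le_mul_of_nonneg_left (sum_weight_mem_urns_le hp a) (Nat.cast_nonneg (α := ℝ) m)
  linarith [hκ a]

theorem fst_mem_urns (q : Fin m → (Fin n × Fin n) × (Fin n × Fin n)) (j : Fin m) :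
    (q j).1.1 ∈ urns (q j) ∧ (q j).1.2 ∈ urns (q j) := by simp [urns]

theorem snd_mem_urns (q : Fin m → (Fin n × Fin n) × (Fin n × Fin n)) (j : Fin m) :
    (q j).2.1 ∈ urns (q j) ∧ (q j).2.2 ∈ urns (q j) := by simp [urns]

/-- The constant in the variance bound for `diffSum`. -/
noncomputable def varConst (K κ : ℝ) : ℝ :=
  32768 * K ^ 4 * Real.exp (Real.exp (8 * K + 5) * (4 * κ))

/-- The coordinates of `diffSum` are pairs of urns, so Efron–Stein resamples pairs: each ball has
four available urns, those of `urns`. The constant is `1/4` of twice the bound in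
`sum_interaction_sq_le`. -/
theorem variance_diffSum_le (hp : IsWeight p) (hκ : ∀ a, m * p a ≤ κ) (hK : 0 < K)
    (hφ : ∀ i k, |φ i k| ≤ K * Real.exp (K * (k : ℕ)))
    {τ : ℝ → ℝ → ℝ} (hτ : ∀ a b, |τ a b| ≤ |a| * |b|) :
    prodExp (m := m) (pairWeight p)
      (fun z => (diffSum φ τ z - prodExp (m := m) (pairWeight p) (diffSum φ τ)) ^ 2) ≤
      varConst K κ * n := by
  refine (prodExp_sq_sub_le hp.pairWeight _).trans ?_
  have h : ∀ q : Fin m → (Fin n × Fin n) × (Fin n × Fin n),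
      ∑ j, resampleDiff (diffSum φ τ) j q ^ 2 + ∑ j, hybridDiff (diffSum φ τ) j q ^ 2 ≤
        131072 * K ^ 4 * expLoad (fun j => urns (q j)) (8 * K + 5) := fun q => by
    have h0 := sum_interaction_sq_le (S := fun j => urns (q j)) hK fun j => card_urns_le _
    have h1 : ∑ j, resampleDiff (diffSum φ τ) j q ^ 2 ≤
        ∑ i, interaction (fun j => urns (q j)) K i ^ 2 := by
      refine Finset.sum_le_sum fun i _ => sq_le_sq' (neg_le_of_abs_le ?_) (le_of_abs_le ?_) <;>
      · refine abs_diffSum_sub_le hK hφ hτ (fst_mem_urns q) (fun j => ?_) (resample_agree q i)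
        unfold resample; split_ifs
        exacts [snd_mem_urns q j, fst_mem_urns q j]
    have h2 : ∑ j, hybridDiff (diffSum φ τ) j q ^ 2 ≤
        ∑ i, interaction (fun j => urns (q j)) K i ^ 2 := by
      have hm : ∀ k j, (hybrid k q j).1 ∈ urns (q j) ∧ (hybrid k q j).2 ∈ urns (q j) :=
        fun k j => by
          unfold hybrid; split_ifs
          exacts [snd_mem_urns q j, fst_mem_urns q j]
      refine Finset.sum_le_sum fun i _ => sq_le_sq' (neg_le_of_abs_le ?_) (le_of_abs_le ?_) <;>
      exact abs_diffSum_sub_le hK hφ hτ (hm _) (hm _) (hybrid_succ_agree q i)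
    linarith
  have h3 := prodExp_mono hp.pairWeight.pairWeight h
  rw [prodExp_const_mul] at h3
  have h4 := mul_le_mul_of_nonneg_left (prodExp_expLoad_urns_le hp hκ (L := 8 * K + 5)
    (by positivity)) (show 0 ≤ 131072 * K ^ 4 by positivity)
  unfold varConst
  linarith

/-- The constant in the bound for the moments of the differences. -/
noncomputable def momentConst (K κ : ℝ) (k : ℕ) : ℝ :=
  (2 * K) ^ (k + 1) * 4 ^ k * Real.exp (Real.exp ((k + 1) * K + 1) * (4 * κ))

theorem prodExp_sum_localLoad_pow_le (hp : IsWeight p) (hκ : ∀ a, m * p a ≤ κ) (hK : 0 < K)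
    (k : ℕ) :
    prodExp (pairWeight (pairWeight p))
      (fun q : Fin m → (Fin n × Fin n) × (Fin n × Fin n) =>
        ∑ j, (2 * K * localLoad (fun j => urns (q j)) K j) ^ (k + 1)) ≤ momentConst K κ k * n := by
  have h : ∀ q : Fin m → (Fin n × Fin n) × (Fin n × Fin n),
      ∑ j, (2 * K * localLoad (fun j => urns (q j)) K j) ^ (k + 1) ≤
        ((2 * K) ^ (k + 1) * 4 ^ k) * expLoad (fun j => urns (q j)) ((k + 1) * K + 1) := fun q => by
    simp_rw [mul_pow (2 * K)]
    rw [← Finset.mul_sum, mul_assoc]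
    exact mul_le_mul_of_nonneg_left
      (sum_localLoad_pow_le (S := fun j => urns (q j)) (fun j => card_urns_le _) K k)
      (by positivity)
  have h3 := prodExp_mono hp.pairWeight.pairWeight h
  rw [prodExp_const_mul] at h3
  have h4 := mul_le_mul_of_nonneg_left (prodExp_expLoad_urns_le hp hκ (L := (k + 1) * K + 1)
    (by positivity)) (show 0 ≤ (2 * K) ^ (k + 1) * 4 ^ k by positivity)
  unfold momentConst
  linarith

/-- The third order term in the expansion of the Stein equation. -/
noncomputable def cubicSum (φ : Fin n → ℕ → ℝ) (z : Fin m → Fin n × Fin n) : ℝ :=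
  ∑ j, |hybridDiff (functional φ) j z| * resampleDiff (functional φ) j z ^ 2

theorem cubicSum_nonneg (z : Fin m → Fin n × Fin n) : 0 ≤ cubicSum φ z :=
  Finset.sum_nonneg fun _ _ => by positivity

theorem cubicSum_le (hK : 0 < K) (hφ : ∀ i k, |φ i k| ≤ K * Real.exp (K * (k : ℕ)))
    (q : Fin m → (Fin n × Fin n) × (Fin n × Fin n)) :
    cubicSum φ (fun j => (q j).1) ≤ ∑ j, (2 * K * localLoad (fun j => urns (q j)) K j) ^ 3 := by
  refine Finset.sum_le_sum fun j _ => ?_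
  have h1 := abs_hybridDiff_functional_le hK hφ (fst_mem_urns q) j
  have h2 := abs_resampleDiff_functional_le hK hφ (fst_mem_urns q) j
  rw [pow_succ' _ 2, ← sq_abs (resampleDiff _ _ _)]
  exact mul_le_mul h1 (pow_le_pow_left₀ (abs_nonneg _) h2 2) (sq_nonneg _)
    ((abs_nonneg _).trans h1)

theorem prodExp_cubicSum_le (hp : IsWeight p) (hκ : ∀ a, m * p a ≤ κ) (hK : 0 < K)
    (hφ : ∀ i k, |φ i k| ≤ K * Real.exp (K * (k : ℕ))) :
    prodExp (m := m) (pairWeight p) (cubicSum φ) ≤ momentConst K κ 2 * n := by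
  -- The expectation is lifted to pairs of pairs so that the four-urn load bounds apply again.
  rw [← prodExp_comp_fst hp.pairWeight]
  exact (prodExp_mono hp.pairWeight.pairWeight (cubicSum_le hK hφ)).trans
    (prodExp_sum_localLoad_pow_le hp hκ hK 2)

/-- Cauchy–Schwarz over the balls costs the factor `m`. As `m ≤ κ n` in the application, the square
root is still of order `n`. -/
theorem prodExp_cubicSum_sq_le (hp : IsWeight p) (hκ : ∀ a, m * p a ≤ κ) (hK : 0 < K)
    (hφ : ∀ i k, |φ i k| ≤ K * Real.exp (K * (k : ℕ))) :
    prodExp (m := m) (pairWeight p) (fun z => cubicSum φ z ^ 2) ≤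
      m * (momentConst K κ 5 * n) := by
  rw [← prodExp_comp_fst hp.pairWeight (fun z => cubicSum φ z ^ 2)]
  have h : ∀ q : Fin m → (Fin n × Fin n) × (Fin n × Fin n),
      cubicSum φ (fun j => (q j).1) ^ 2 ≤
        m * ∑ j, (2 * K * localLoad (fun j => urns (q j)) K j) ^ (5 + 1) := fun q => by
    refine (pow_le_pow_left₀ (cubicSum_nonneg _) (cubicSum_le hK hφ q) 2).trans ?_
    refine sq_sum_le_card_mul_sum_sq.trans (le_of_eq ?_)
    simp only [Finset.card_univ, Fintype.card_fin, ← pow_mul]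
  refine (prodExp_mono hp.pairWeight.pairWeight h).trans ?_
  rw [prodExp_const_mul]
  exact mul_le_mul_of_nonneg_left (prodExp_sum_localLoad_pow_le hp hκ hK 5) (Nat.cast_nonneg m)

/-- The bound on the Kolmogorov distance for the configuration space. -/
theorem abs_prodExp_indicator_sub_cdf_le (hp : IsWeight p) (hκ : ∀ a, m * p a ≤ κ) (hK : 0 < K)
    (hφ : ∀ i k, |φ i k| ≤ K * Real.exp (K * (k : ℕ))) (hm : (m : ℝ) ≤ κ * n) {s : ℝ} (hs : 0 < s)
    {μ : ℝ} (hμ : prodExp (m := m) p (functional φ) = μ)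
    (hs2 : prodExp (m := m) p (fun x => (functional φ x - μ) ^ 2) = s ^ 2) (t : ℝ) :
    |prodExp (m := m) p (fun x => if (functional φ x - μ) / s ≤ t then 1 else 0) -
      NormalStein.cdf t| ≤
      2 * √(varConst K κ) * (√n / s ^ 2) +
        (3 * √(κ * momentConst K κ 5) + 9 * momentConst K κ 2) / 2 * (n / s ^ 3) := by
  have hpp := hp.pairWeight
  set V : (Fin m → Fin n) → ℝ := functional φ with hV
  set W : (Fin m → Fin n) → ℝ := fun x => (V x - μ) / s with hW
  have hVW : ∀ x, V x = s * W x + μ := fun x => by simp only [hW]; field_simp; ring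
  set T₁ := diffSum (m := m) φ fun a b => a * b with hT₁
  set T₂ := diffSum (m := m) φ fun a b => |b| * a with hT₂
  have hvar1 := variance_diffSum_le (m := m) hp hκ hK hφ (τ := fun a b => a * b)
    fun a b => (abs_mul a b).le
  have hvar2 := variance_diffSum_le (m := m) hp hκ hK hφ (τ := fun a b => |b| * a)
    fun a b => by rw [abs_mul, abs_abs, mul_comm]
  rw [← hT₁] at hvar1
  rw [← hT₂] at hvar2
  have hET1 : prodExp (pairWeight p) T₁ = 2 * s ^ 2 := by
    have h := prodExp_sum_resampleDiff_mul_hybridDiff hp V V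
    have h2 : prodExp p (fun x => (V x - μ) ^ 2) = prodExp p (fun x => V x * V x) - μ * μ := by
      have : (fun x => (V x - μ) ^ 2) = fun x => (V x * V x - (2 * μ) * V x) + μ ^ 2 := by
        funext x; ring
      rw [this, prodExp_add, prodExp_sub, prodExp_const_mul, prodExp_const hp, hμ]
      ring
    rw [hμ, ← h2, hs2] at h
    exact h
  have hanti : ∀ j z, |hybridDiff V j (swapAt j z)| * resampleDiff V j (swapAt j z) =
      -(|hybridDiff V j z| * resampleDiff V j z) := fun j z => by
    rw [hybridDiff_swapAt, resampleDiff_swapAt, abs_neg]; ring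
  have hET2 : prodExp (pairWeight p) T₂ = 0 := by
    have h : ∀ j, prodExp (pairWeight p)
        (fun z => |hybridDiff V j z| * resampleDiff V j z) = 0 := fun j => by
      -- Symmetrising against the constant `1` shows that an antisymmetric function has mean zero.
      have := prodExp_fst_mul_of_antisymm (w := p) (fun _ => 1) j
        (fun z => |hybridDiff V j z| * resampleDiff V j z) (hanti j)
      have h0 : ∀ z, resampleDiff (fun _ : Fin m → Fin n => (1 : ℝ)) j z = 0 :=
        fun z => sub_self _
      simp only [h0, zero_mul, one_mul] at this
      rw [prodExp_const hpp] at this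
      linarith
    exact (prodExp_sum _ _).trans (Finset.sum_eq_zero fun j _ => h j)
  have hdev1 : prodExp (pairWeight p) (fun z => |T₁ z - 2 * s ^ 2|) ≤
      √(varConst K κ) * √n := by
    rw [hET1] at hvar1
    rw [← Real.sqrt_mul' _ (Nat.cast_nonneg n)]
    exact (prodExp_abs_le_sqrt hpp _).trans (Real.sqrt_le_sqrt hvar1)
  have hdev2 : prodExp (pairWeight p) (fun z => |T₂ z|) ≤ √(varConst K κ) * √n := by
    rw [hET2] at hvar2
    simp only [sub_zero] at hvar2
    rw [← Real.sqrt_mul' _ (Nat.cast_nonneg n)]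
    exact (prodExp_abs_le_sqrt hpp _).trans (Real.sqrt_le_sqrt hvar2)
  set f : (Fin m → Fin n) → ℝ := fun x => NormalStein.sol t (W x) with hf
  set g : (Fin m → Fin n) → ℝ := fun x => if W x ≤ t then 1 else 0 with hg
  have hEW2 : prodExp p (fun x => W x ^ 2) = 1 := by
    have : (fun x => W x ^ 2) = fun x => (1 / s ^ 2) * (V x - μ) ^ 2 := by
      funext x; simp only [hW, div_pow]; ring
    rw [this, prodExp_const_mul, hs2]
    field_simp
  -- the characterising identity of the normal law, in its approximate form
  have hstein : prodExp (pairWeight p) (fun z => ∑ j, resampleDiff f j z * hybridDiff V j z) =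
      2 * s * prodExp p (fun x => W x * f x) := by
    rw [prodExp_sum_resampleDiff_mul_hybridDiff hp f V, hμ]
    have : (fun x => f x * V x) = fun x => s * (W x * f x) + μ * f x := by
      funext x; rw [hVW]; ring
    rw [this, prodExp_add, prodExp_const_mul, prodExp_const_mul]
    ring
  -- The definition of `solDeriv` makes the Stein equation hold at every point, `t` included;
  -- `hstein` then replaces `E W f(W)`.
  have hderiv : prodExp p g - NormalStein.cdf t =
      prodExp (pairWeight p) (fun z => NormalStein.solDeriv t (W fun j => (z j).1) -
        (1 / (2 * s)) * ∑ j, resampleDiff f j z * hybridDiff V j z) := by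
    rw [prodExp_sub, prodExp_const_mul, hstein,
      prodExp_comp_fst hp (fun x => NormalStein.solDeriv t (W x))]
    simp only [NormalStein.solDeriv]
    rw [prodExp_add, prodExp_sub, prodExp_const hp]
    field_simp
    ring
  -- The collected jump terms. The sign `-1` appears because the remainder bound has the indicators
  -- in the opposite order to `resampleDiff g`.
  set U : (Fin m → Fin n × Fin n) → ℝ := fun z => ∑ j, (-1 : ℝ) * (resampleDiff g j z *
    (|hybridDiff V j z| * resampleDiff V j z)) with hU
  -- Symmetrisation gives `E U = -2 E (g T₂)`, and `0 ≤ g ≤ 1`.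
  have hEU : prodExp (pairWeight p) U ≤ 2 * (√(varConst K κ) * √n) := by
    have h1 : prodExp (pairWeight p) U = prodExp (pairWeight p)
        (fun z => (-2 : ℝ) * (g (fun i => (z i).1) * T₂ z)) := by
      rw [hU, prodExp_sum, prodExp_const_mul]
      simp_rw [prodExp_const_mul]
      simp_rw [fun j => prodExp_fst_mul_of_antisymm (w := p) g j
        (fun z => |hybridDiff V j z| * resampleDiff V j z) (hanti j)]
      simp only [hT₂, diffSum, Finset.mul_sum]
      rw [prodExp_sum, Finset.mul_sum]
      exact Finset.sum_congr rfl fun j _ => by ring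
    have h2 : prodExp (pairWeight p) (fun z => (-2 : ℝ) * (g (fun i => (z i).1) * T₂ z)) ≤
        prodExp (pairWeight p) (fun z => 2 * |T₂ z|) := by
      refine prodExp_mono hpp fun z => ?_
      simp only [hg]
      split_ifs
      · linarith [neg_abs_le (T₂ z)]
      · simp
    rw [h1]
    rw [prodExp_const_mul 2] at h2
    linarith
  have hpt : ∀ z : Fin m → Fin n × Fin n, |NormalStein.solDeriv t (W fun j => (z j).1) -
        (1 / (2 * s)) * ∑ j, resampleDiff f j z * hybridDiff V j z| ≤
      (1 / s ^ 2) * |T₁ z - 2 * s ^ 2| + ((1 / (2 * s ^ 3)) *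
        (3 * (cubicSum φ z * |W fun j => (z j).1|) + 9 * cubicSum φ z) +
          (1 / (2 * s ^ 2)) * U z) := fun z => by
    set w := W fun j => (z j).1 with hw
    set B := NormalStein.solDeriv t w with hB
    have hr : ∀ j, w - W (resample j z) = resampleDiff V j z / s := fun j => by
      simp only [hw, hW, resampleDiff]; field_simp; ring
    have hj : ∀ j, |resampleDiff f j z * hybridDiff V j z -
        resampleDiff V j z * hybridDiff V j z * (B / s)| ≤
        (1 / s ^ 2) * (|hybridDiff V j z| * resampleDiff V j z ^ 2) * (3 * |w| + 9) +
        (1 / s) * ((-1 : ℝ) * (resampleDiff g j z *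
          (|hybridDiff V j z| * resampleDiff V j z))) := fun j => by
      have h := NormalStein.abs_sol_sub_sol_sub_le t w (W (resample j z))
      rw [hr] at h
      have e : resampleDiff f j z * hybridDiff V j z -
          resampleDiff V j z * hybridDiff V j z * (B / s) =
          hybridDiff V j z * (NormalStein.sol t w - NormalStein.sol t (W (resample j z)) -
            resampleDiff V j z / s * NormalStein.solDeriv t w) := by
        simp only [resampleDiff, hf, hB, hw]; ring
      have e2 : resampleDiff g j z = (if w ≤ t then 1 else 0) -
        (if W (resample j z) ≤ t then 1 else 0) := rfl
      rw [e, abs_mul]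
      refine (mul_le_mul_of_nonneg_left h (abs_nonneg _)).trans (le_of_eq ?_)
      rw [e2]
      field_simp
      ring
    have hsum : |∑ j, resampleDiff f j z * hybridDiff V j z - T₁ z * (B / s)| ≤
        (1 / s ^ 2) * cubicSum φ z * (3 * |w| + 9) + (1 / s) * U z := by
      have e : ∑ j, resampleDiff f j z * hybridDiff V j z - T₁ z * (B / s) =
          ∑ j, (resampleDiff f j z * hybridDiff V j z -
            resampleDiff V j z * hybridDiff V j z * (B / s)) := by
        rw [Finset.sum_sub_distrib, ← Finset.sum_mul]
        rfl
      rw [e]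
      refine (Finset.abs_sum_le_sum_abs _ _).trans
        ((Finset.sum_le_sum fun j _ => hj j).trans (le_of_eq ?_))
      rw [Finset.sum_add_distrib, ← Finset.mul_sum, ← Finset.sum_mul, ← Finset.mul_sum]
      rfl
    have hBle : |B| ≤ 2 := NormalStein.abs_solDeriv_le t w
    -- Splits off the deviation of `T₁` from its mean; what is left is the linearisation error
    -- bounded in `hsum`.
    have e : B - (1 / (2 * s)) * ∑ j, resampleDiff f j z * hybridDiff V j z =
        -(B * ((T₁ z - 2 * s ^ 2) / (2 * s ^ 2))) -
        (1 / (2 * s)) * (∑ j, resampleDiff f j z * hybridDiff V j z - T₁ z * (B / s)) := by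
      field_simp; ring
    rw [e]
    refine (abs_sub _ _).trans ?_
    rw [abs_neg, abs_mul, abs_mul, abs_div, abs_of_pos (show 0 < 2 * s ^ 2 by positivity),
      abs_of_pos (show 0 < 1 / (2 * s) by positivity)]
    have h1 : |B| * (|T₁ z - 2 * s ^ 2| / (2 * s ^ 2)) ≤ (1 / s ^ 2) * |T₁ z - 2 * s ^ 2| := by
      refine (mul_le_mul_of_nonneg_right hBle (by positivity)).trans (le_of_eq ?_)
      field_simp
    refine add_le_add h1 ((mul_le_mul_of_nonneg_left hsum (by positivity)).trans (le_of_eq ?_))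
    field_simp
  have hcub1 := prodExp_cubicSum_le (m := m) hp hκ hK hφ
  -- Cauchy–Schwarz with `E W² = 1` removes the unbounded factor `|W|`.
  have hcub2 : prodExp (pairWeight p) (fun z => cubicSum φ z * |W fun j => (z j).1|) ≤
      √(κ * momentConst K κ 5) * n := by
    refine (prodExp_mul_le_sqrt hpp _ _).trans ?_
    simp only [sq_abs]
    rw [prodExp_comp_fst hp (fun x => W x ^ 2), hEW2, Real.sqrt_one, mul_one]
    have h0 : 0 ≤ momentConst K κ 5 := by unfold momentConst; positivity
    rw [← Real.sqrt_sq (Nat.cast_nonneg (α := ℝ) n), ← Real.sqrt_mul' _ (sq_nonneg _)]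
    refine Real.sqrt_le_sqrt ((prodExp_cubicSum_sq_le hp hκ hK hφ).trans ?_)
    have := mul_le_mul_of_nonneg_right hm (mul_nonneg h0 (Nat.cast_nonneg (α := ℝ) n))
    linarith
  rw [hderiv]
  refine (abs_prodExp_le hpp _).trans ((prodExp_mono hpp hpt).trans ?_)
  rw [prodExp_add, prodExp_add, prodExp_const_mul, prodExp_const_mul, prodExp_const_mul,
    prodExp_add, prodExp_const_mul, prodExp_const_mul]
  have i1 := mul_le_mul_of_nonneg_left hdev1 (show 0 ≤ 1 / s ^ 2 by positivity)
  have i2 := mul_le_mul_of_nonneg_left hEU (show 0 ≤ 1 / (2 * s ^ 2) by positivity)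
  have i3 := mul_le_mul_of_nonneg_left (add_le_add
    (mul_le_mul_of_nonneg_left hcub2 (show (0 : ℝ) ≤ 3 by norm_num))
    (mul_le_mul_of_nonneg_left hcub1 (show (0 : ℝ) ≤ 9 by norm_num)))
    (show 0 ≤ 1 / (2 * s ^ 3) by positivity)
  refine (add_le_add i1 (add_le_add i3 i2)).trans (le_of_eq ?_)
  field_simp
  ring

end NormalApproximation

end Occupancy

/-! ### Passage from the probability space to configurations, and the conclusion. -/

namespace Occupancy

section Transfer

variable {Ω : Type*} [MeasurableSpace Ω] {P : Measure Ω} {m n : ℕ}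
  {p : Fin n → ℝ} {X : Fin m → Ω → Fin n}

theorem IsUrnScheme.measurable_config (hX : IsUrnScheme P p X) :
    Measurable fun ω j => X j ω :=
  measurable_pi_lambda _ hX.measurable

theorem IsUrnScheme.real_config_eq (hX : IsUrnScheme P p X) (x : Fin m → Fin n) :
    (P.map fun ω j => X j ω).real {x} = ∏ j, p (x j) := by
  rw [map_measureReal_apply hX.measurable_config (measurableSet_singleton x)]
  have e : (fun ω j => X j ω) ⁻¹' {x} = ⋂ j ∈ Finset.univ, X j ⁻¹' {x j} := by
    ext ω; simp [funext_iff]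
  rw [e, measureReal_def, hX.indep.measure_inter_preimage_eq_mul Finset.univ
    (fun j _ => measurableSet_singleton (x j)), ENNReal.toReal_prod]
  exact Finset.prod_congr rfl fun j _ => hX.law j (x j)

variable [IsProbabilityMeasure P]

theorem IsUrnScheme.integral_config (hX : IsUrnScheme P p X) (F : (Fin m → Fin n) → ℝ) :
    ∫ ω, F (fun j => X j ω) ∂P = prodExp p F := by
  have : IsProbabilityMeasure (P.map fun ω j => X j ω) :=
    Measure.isProbabilityMeasure_map hX.measurable_config.aemeasurable
  rw [← integral_map (φ := fun ω j => X j ω) hX.measurable_config.aemeasurable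
    (measurable_of_finite F).aestronglyMeasurable, integral_fintype Integrable.of_finite]
  simp only [hX.real_config_eq, smul_eq_mul, prodExp]

theorem IsUrnScheme.integrable_config (hX : IsUrnScheme P p X) (F : (Fin m → Fin n) → ℝ) :
    Integrable (fun ω => F (fun j => X j ω)) P := by
  have : IsProbabilityMeasure (P.map fun ω j => X j ω) :=
    Measure.isProbabilityMeasure_map hX.measurable_config.aemeasurable
  exact (Integrable.of_finite (f := F) (μ := P.map fun ω j => X j ω)).comp_measurable
    hX.measurable_config

variable {φ : Fin n → ℕ → ℝ}

theorem IsUrnScheme.W_eq (hX : IsUrnScheme P p X) (ω : Ω) :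
    W P X φ ω = (functional φ (fun j => X j ω) - prodExp (m := m) p (functional φ)) / sd P X φ := by
  have h : ∑ i, mean P X φ i = prodExp (m := m) p (functional φ) := by
    unfold functional
    rw [prodExp_sum]
    exact Finset.sum_congr rfl fun i _ => hX.integral_config fun x => φ i (occ x i)
  unfold W
  rw [Finset.sum_sub_distrib, h, one_div, inv_mul_eq_div]
  rfl

theorem IsUrnScheme.sd_sq (hX : IsUrnScheme P p X) :
    prodExp (m := m) p (fun x => (functional φ x - prodExp (m := m) p (functional φ)) ^ 2) =
      sd P X φ ^ 2 := by
  have hV : V X φ = fun ω => functional φ fun j => X j ω := rfl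
  rw [sd, Real.sq_sqrt (variance_nonneg _ _), hV,
    variance_eq_integral (hX.integrable_config (functional φ)).aemeasurable]
  have h := hX.integral_config (functional φ)
  have h2 := hX.integral_config
    fun x => (functional φ x - prodExp (m := m) p (functional φ)) ^ 2
  rw [← h2, ← h]

theorem IsUrnScheme.real_map_W_Iic (hX : IsUrnScheme P p X) (t : ℝ) :
    (P.map (W P X φ)).real (Set.Iic t) = prodExp (m := m) p (fun x =>
      if (functional φ x - prodExp (m := m) p (functional φ)) / sd P X φ ≤ t then 1 else 0) := by
  have e : W P X φ = fun ω => (fun x : Fin m → Fin n =>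
      (functional φ x - prodExp (m := m) p (functional φ)) / sd P X φ) (fun j => X j ω) :=
    funext fun ω => hX.W_eq ω
  have hW : Measurable (W P X φ) := by
    rw [e]
    exact (measurable_of_finite fun x : Fin m → Fin n =>
      (functional φ x - prodExp (m := m) p (functional φ)) / sd P X φ).comp hX.measurable_config
  rw [map_measureReal_apply hW measurableSet_Iic, ← hX.integral_config,
    ← integral_indicator_one (hW measurableSet_Iic)]
  congr 1
  funext ω
  simp only [Set.indicator, Set.mem_preimage, Set.mem_Iic, hX.W_eq, Pi.one_apply]

end Transfer

end Occupancy

theorem theorem9 (K₁ K₂ K₃ : ℝ) (hK₁ : 0 < K₁) (hK₂ : 0 < K₂) (hK₃ : 0 < K₃) :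
    ∃ C : ℝ, 0 < C ∧
      ∀ (Ω : Type*) [MeasurableSpace Ω] (P : Measure Ω) [IsProbabilityMeasure P] (m n : ℕ)
        (p : Fin n → ℝ) (X : Fin m → Ω → Fin n) (φ : Fin n → ℕ → ℝ),
        (∀ i, 0 ≤ p i) → ∑ i, p i = 1 →
        Occupancy.IsUrnScheme P p X →
        (∀ (i : Fin n) (x : ℕ), |φ i x| ≤ K₁ * Real.exp (K₁ * x)) →
        (∀ i, p i ≤ K₂ / m) →
        (n : ℝ) ≤ K₃ * m →
        0 < Occupancy.sd P X φ →
        kolmogorovDist (P.map (Occupancy.W P X φ)) (gaussianReal 0 1) ≤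
          C * (√n / Occupancy.sd P X φ ^ 2 + n / Occupancy.sd P X φ ^ 3) := by
  set A := 2 * √(Occupancy.varConst K₁ K₂) with hA
  set B := (3 * √(K₂ * Occupancy.momentConst K₁ K₂ 5) + 9 * Occupancy.momentConst K₁ K₂ 2) / 2
    with hB
  have hB0 : 0 < Occupancy.momentConst K₁ K₂ 2 := by unfold Occupancy.momentConst; positivity
  refine ⟨A + B, by positivity, ?_⟩
  intro Ω _ P _ m n p X φ hp0 hp1 hX hφ hpm _ hs
  have hp : Occupancy.IsWeight p := ⟨hp0, hp1⟩
  have hm0 : (0 : ℝ) < m := by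
    -- If `m = 0`, then `K₂ / m` is `0`, which contradicts `∑ p i = 1`.
    rcases Nat.eq_zero_or_pos m with h | h
    · subst h
      have : ∑ i, p i ≤ 0 := Finset.sum_nonpos fun i _ => by simpa using hpm i
      linarith
    · exact_mod_cast h
  have hκ : ∀ i, m * p i ≤ K₂ := fun i => by
    have := hpm i
    rwa [le_div_iff₀ hm0, mul_comm] at this
  -- Summing `m * p i ≤ K₂` over the urns bounds the number of balls by that of urns.
  have hm : (m : ℝ) ≤ K₂ * n := by
    have := Finset.sum_le_sum fun i (_ : i ∈ Finset.univ) => hκ i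
    rw [← Finset.mul_sum, hp1] at this
    simpa [mul_comm] using this
  refine ciSup_le fun t => ?_
  rw [hX.real_map_W_Iic]
  have h := Occupancy.abs_prodExp_indicator_sub_cdf_le hp hκ hK₁ hφ hm hs rfl hX.sd_sq t
  rw [← hA, ← hB] at h
  refine h.trans ?_
  have h1 : 0 ≤ √(n : ℝ) / Occupancy.sd P X φ ^ 2 := by positivity
  have h2 : 0 ≤ (n : ℝ) / Occupancy.sd P X φ ^ 3 := by positivity
  have hA0 : 0 ≤ A := by positivity
  have hB1 : 0 ≤ B := by positivity
  nlinarith [mul_nonneg hA0 h2, mul_nonneg hB1 h1]
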